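/- **Corollary 1.** For $\theta\ge 0$ let $K(\theta)=\{z\in\mathbb{C}: |\arg z|\le\theta\}$, with $0\in K(\theta)$. A complex sequence $\mathbf{c}=\{c_n\}$ belongs to the class $\mathrm{GBV}$ if there is $\theta_1\in[0,\pi/2)$ with $c_n\in K(\theta_1)$ for all $n\ge 1$, and there are an integer $N_0\ge 1$ and a constant $M>0$ such that $$\sum_{n=m}^{2m}|c_n-c_{n+1}|\le M\max_{m\le n<m+N_0}|c_n|\qquad\text{for all } m=1,2,\dots$$ (no condition is imposed on $c_0$). Let $f:\mathbb{R}\to\mathbb{C}$ be $2\pi$-periodic and integrable on $[-\pi,\pi]$, let $\hat f(k)=\frac1{2\pi}\int_{-\pi}^{\pi}f(x)e^{-ikx}\,dx$ for $k\in\mathbb{Z}$, let $S_n(f,x)=\sum_{k=-n}^{n}\hat f(k)e^{ikx}$, and let $\|g\|=\int_{-\pi}^{\pi}|g(x)|\,dx$. If both $\{\hat f(n)\}_{n\ge 0}$ and $\{\hat f(-n)\}_{n\ge 0}$ belong to $\mathrm{GBV}$, then $$\lim_{n\to\infty}\|f-S_n(f)\|=0\quad\text{if and only if}\quad \lim_{|n|\to\infty}\hat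 f(n)\log|n|=0,$$ where in the second limit $n$ runs over the integers, so that both $n\to+\infty$ and $n\to-\infty$ are meant. -/

import Mathlib

open Filter Topology MeasureTheory

noncomputable section

namespace GBVFourier

/-- The closed sector `{z : |arg z| ≤ θ}`. It contains `0`, as `Complex.arg 0 = 0`. -/
def sector (θ : ℝ) : Set ℂ := {z | |Complex.arg z| ≤ θ}

/-- The class GBV. Only the terms `c n` with `n ≥ 1` matter. The maximum of `|c n|` over the
nonempty window `m ≤ n < m + N₀` is written as a finite supremum of nonnegative reals. -/
def IsGBV (c : ℕ → ℂ) : Prop :=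
  (∃ θ : ℝ, 0 ≤ θ ∧ θ < Real.pi / 2 ∧ ∀ n : ℕ, 1 ≤ n → c n ∈ sector θ) ∧
  ∃ N₀ : ℕ, 1 ≤ N₀ ∧ ∃ M : ℝ, 0 < M ∧ ∀ m : ℕ, 1 ≤ m →
    ∑ n ∈ Finset.Icc m (2 * m), ‖c n - c (n + 1)‖ ≤
      M * ((Finset.Ico m (m + N₀)).sup (fun n => ‖c n‖₊) : NNReal)

/-- The `n`-th Fourier coefficient of a `2π`-periodic function, over the period `(-π, π]`. -/
def coeff (f : ℝ → ℂ) (n : ℤ) : ℂ :=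
  fourierCoeffOn (neg_lt_self Real.pi_pos) f n

theorem coeff_eq_integral (f : ℝ → ℂ) (n : ℤ) :
    coeff f n = (1 / (2 * Real.pi) : ℝ) •
      ∫ x in (-Real.pi)..Real.pi, Complex.exp (-(Complex.I * n * x)) * f x := by
  rw [coeff, fourierCoeffOn_eq_integral]
  have hp : (Real.pi : ℂ) ≠ 0 := by exact_mod_cast Real.pi_ne_zero
  congr 1
  · congr 1; ring
  · refine intervalIntegral.integral_congr fun x _ => ?_
    simp only [fourier_coe_apply, smul_eq_mul]
    congr 2
    push_cast
    field_simp
    ring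

/-- The symmetric partial sum `∑_{k=-n}^{n} f̂(k) e^{ikx}`. -/
def partialSum (f : ℝ → ℂ) (n : ℕ) (x : ℝ) : ℂ :=
  ∑ k ∈ Finset.Icc (-(n : ℤ)) (n : ℤ), coeff f k * Complex.exp (Complex.I * k * x)

/-- The norm `∫_{-π}^{π} |g(x)| dx`. -/
def l1Norm (g : ℝ → ℂ) : ℝ := ∫ x in (-Real.pi)..Real.pi, ‖g x‖

end GBVFourier

end

/-!
Necessity. Multiplying `f - S_n f` by `e^{-inx}` and pairing it with the uniformly bounded sums
`∑_{k ≤ 2n} sin(kx)/k` bounds `|∑_{k ≤ 2n} f̂(n + k)/k|` by a multiple of `‖f - S_n f‖`. The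
coefficients lie in a sector of half-angle less than `π/2`, so nothing cancels and the same bound
holds for `∑ |f̂(n + k)|/k`. By the group variation condition, `|f̂(j)|` with `⌊j/2⌋ = n` is at most
a constant times the sum over any window of `N₀` consecutive coefficients starting between `n + 1`
and `2n`, so this sum dominates `|f̂(j)| log n`. Reflecting `f` gives the negative frequencies.

Sufficiency. The de la Vallée Poussin mean of order `n`, the average of `S_m f` over `n ≤ m < 2n`,
converges to `f` in `L¹`, its kernel being a difference of two Fejér kernels and so bounded in `L¹`.
It differs from `S_n f` by an average of `S_m f - S_n f`, and each of these is small: Abel summation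
bounds the `L¹` norm of a block of the Fourier series by `log n` times the size plus the variation
of its coefficients, and the group variation condition bounds the variation by the size.
-/

namespace GBVFourier

open Finset Real

section Summation

theorem norm_sum_range_smul_le {R E : Type*} [SeminormedRing R] [SeminormedAddCommGroup E]
    [Module R E] [IsBoundedSMul R E] (a : ℕ → R) {z : ℕ → E} {N : ℕ} {C : ℝ}
    (hz : ∀ j ≤ N + 1, ‖∑ i ∈ range j, z i‖ ≤ C) :
    ‖∑ l ∈ range (N + 1), a l • z l‖ ≤ (‖a N‖ + ∑ l ∈ range N, ‖a (l + 1) - a l‖) * C := by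
  rw [sum_range_by_parts, Nat.add_sub_cancel, add_mul, sum_mul]
  refine norm_sub_le_of_le ?_ (norm_sum_le_of_le _ fun l hl => ?_)
  · exact (norm_smul_le _ _).trans (mul_le_mul_of_nonneg_left (hz _ le_rfl) (norm_nonneg _))
  · exact (norm_smul_le _ _).trans (mul_le_mul_of_nonneg_left (hz _ (by grind)) (norm_nonneg _))

theorem norm_sum_range_smul_le_of_antitone {E : Type*} [SeminormedAddCommGroup E]
    [NormedSpace ℝ E] {a : ℕ → ℝ} (ha : Antitone a) (ha0 : ∀ n, 0 ≤ a n) {z : ℕ → E} {N : ℕ}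
    {C : ℝ} (hz : ∀ j ≤ N, ‖∑ i ∈ range j, z i‖ ≤ C) :
    ‖∑ l ∈ range N, a l • z l‖ ≤ a 0 * C := by
  obtain _ | N := N
  · simpa using mul_nonneg (ha0 0) ((norm_nonneg _).trans (hz 0 le_rfl))
  have hvar : ∀ l, ‖a (l + 1) - a l‖ = a l - a (l + 1) := fun l => by
    rw [norm_sub_rev, norm_of_nonneg (sub_nonneg.2 (ha l.le_succ))]
  refine (norm_sum_range_smul_le a hz).trans_eq ?_
  simp only [hvar, sum_range_sub', norm_of_nonneg (ha0 N), add_sub_cancel]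

theorem sum_Icc_neg_add {E : Type*} [AddCommGroup E] (F : ℤ → E) (n N : ℕ) :
    ∑ k ∈ Icc (-((n + N : ℕ) : ℤ)) ((n + N : ℕ) : ℤ), F k
      = ∑ k ∈ Icc (-(n : ℤ)) n, F k + ∑ l ∈ range N, (F (n + 1 + l) + F (-(n + 1 + l))) := by
  induction N with
  | zero => simp
  | succ N ih =>
    rw [sum_range_succ, ← add_assoc (∑ k ∈ _, F k), ← ih, ← add_assoc n, Nat.cast_succ,
      sum_Icc_succ_eq_add_endpoints, add_comm]
    push_cast
    rw [add_right_comm (n : ℤ) N 1]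

theorem sum_Icc_neg {E : Type*} [AddCommGroup E] (F : ℤ → E) (N : ℕ) :
    ∑ k ∈ Icc (-(N : ℤ)) N, F k = F 0 + ∑ l ∈ range N, (F (l + 1) + F (-(l + 1))) := by
  simpa [add_comm (1 : ℤ)] using sum_Icc_neg_add F 0 N

end Summation

section Waves

/-- The character `x ↦ e^{ikx}` of the circle, written so that the summands of `partialSum` are
definitionally multiples of it. -/
noncomputable def wave (k : ℤ) (x : ℝ) : ℂ := Complex.exp (Complex.I * k * x)

theorem wave_eq_exp_ofReal_mul_I (k : ℤ) (x : ℝ) :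
    wave k x = Complex.exp (((k * x : ℝ) : ℂ) * Complex.I) := by
  rw [wave]
  push_cast
  ring_nf

@[simp]
theorem wave_zero (x : ℝ) : wave 0 x = 1 := by simp [wave]

theorem wave_add (k l : ℤ) (x : ℝ) : wave (k + l) x = wave k x * wave l x := by
  simp only [wave, ← Complex.exp_add]
  push_cast
  ring_nf

theorem wave_apply_sub (k : ℤ) (x y : ℝ) : wave k (x - y) = wave k x * wave (-k) y := by
  simp only [wave, ← Complex.exp_add]
  push_cast
  ring_nf

theorem wave_apply_neg (k : ℤ) (x : ℝ) : wave k (-x) = wave (-k) x := by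
  simp [wave]

theorem wave_natCast (n : ℕ) (x : ℝ) : wave n x = wave 1 x ^ n := by
  rw [wave, wave, ← Complex.exp_nat_mul]
  push_cast
  ring_nf

@[simp]
theorem norm_wave (k : ℤ) (x : ℝ) : ‖wave k x‖ = 1 := by
  rw [wave_eq_exp_ofReal_mul_I, Complex.norm_exp_ofReal_mul_I]

theorem conj_wave (k : ℤ) (x : ℝ) : starRingEnd ℂ (wave k x) = wave (-k) x := by
  simp [wave, ← Complex.exp_conj]

theorem wave_mul_wave_neg (k : ℤ) (x : ℝ) : wave k x * wave (-k) x = 1 := by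
  rw [← wave_add, add_neg_cancel, wave_zero]

theorem im_wave (k : ℤ) (x : ℝ) : (wave k x).im = sin (k * x) := by
  rw [wave_eq_exp_ofReal_mul_I, Complex.exp_ofReal_mul_I_im]

@[fun_prop]
theorem continuous_wave (k : ℤ) : Continuous (wave k) := by
  unfold wave
  fun_prop

theorem wave_periodic (k : ℤ) : Function.Periodic (wave k) (2 * π) := by
  intro x
  have h : Complex.I * k * ((x + 2 * π : ℝ) : ℂ)
      = Complex.I * k * x + k * (2 * π * Complex.I) := by push_cast; ring
  rw [wave, wave, h, Complex.exp_add, Complex.exp_int_mul_two_pi_mul_I, mul_one]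

theorem integral_wave (k : ℤ) :
    ∫ x in (-π)..π, wave k x = if k = 0 then 2 * (π : ℂ) else 0 := by
  split_ifs with hk
  · simp [hk, ← two_mul]
  · have hends : wave k π = wave k (-π) := by
      rw [← wave_periodic k (-π)]
      ring_nf
    unfold wave at hends ⊢
    rw [integral_exp_mul_complex (by simp [hk]), hends, sub_self, zero_div]

end Waves

section L1Norm

variable {g h : ℝ → ℂ}

theorem neg_pi_le_pi : -π ≤ π := neg_le_self pi_pos.le

theorem l1Norm_nonneg (g : ℝ → ℂ) : 0 ≤ l1Norm g :=
  intervalIntegral.integral_nonneg neg_pi_le_pi fun _ _ => norm_nonneg _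

theorem l1Norm_le_integral {b : ℝ → ℝ} (hg : IntervalIntegrable g volume (-π) π)
    (hb : IntervalIntegrable b volume (-π) π) (hle : ∀ x, |x| ≤ π → ‖g x‖ ≤ b x) :
    l1Norm g ≤ ∫ x in (-π)..π, b x :=
  intervalIntegral.integral_mono_on neg_pi_le_pi hg.norm hb fun x hx => hle x (abs_le.2 hx)

theorem l1Norm_add_le (hg : IntervalIntegrable g volume (-π) π)
    (hh : IntervalIntegrable h volume (-π) π) :
    l1Norm (fun x => g x + h x) ≤ l1Norm g + l1Norm h := by
  unfold l1Norm
  rw [← intervalIntegral.integral_add hg.norm hh.norm]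
  exact l1Norm_le_integral (hg.add hh) (hg.norm.add hh.norm) fun x _ => norm_add_le _ _

theorem l1Norm_sum_le {ι : Type*} (s : Finset ι) {G : ι → ℝ → ℂ}
    (hG : ∀ i ∈ s, IntervalIntegrable (G i) volume (-π) π) :
    l1Norm (fun x => ∑ i ∈ s, G i x) ≤ ∑ i ∈ s, l1Norm (G i) := by
  unfold l1Norm
  rw [← intervalIntegral.integral_finsetSum fun i hi => (hG i hi).norm]
  refine l1Norm_le_integral ?_ ?_ fun x _ => norm_sum_le _ _
  · simpa only [sum_fn] using IntervalIntegrable.sum s hG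
  · simpa only [sum_fn] using IntervalIntegrable.sum s fun i hi => (hG i hi).norm

theorem l1Norm_const_mul (c : ℂ) (g : ℝ → ℂ) : l1Norm (fun x => c * g x) = ‖c‖ * l1Norm g := by
  simp [l1Norm]

theorem l1Norm_wave_mul (k : ℤ) (g : ℝ → ℂ) : l1Norm (fun x => wave k x * g x) = l1Norm g := by
  simp [l1Norm]

theorem l1Norm_comp_neg (g : ℝ → ℂ) : l1Norm (fun x => g (-x)) = l1Norm g := by
  unfold l1Norm
  rw [intervalIntegral.integral_comp_neg fun x => ‖g x‖, neg_neg]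

end L1Norm

section ExpSum

/-- The exponential sum `∑_{0 ≤ l < N} e^{ilx}`. -/
noncomputable def expSum (N : ℕ) (x : ℝ) : ℂ := ∑ l ∈ range N, wave l x

@[fun_prop]
theorem continuous_expSum (N : ℕ) : Continuous (expSum N) := by
  unfold expSum
  fun_prop

theorem expSum_succ (N : ℕ) (x : ℝ) : expSum (N + 1) x = expSum N x + wave N x :=
  sum_range_succ _ _

theorem expSum_succ' (N : ℕ) (x : ℝ) : expSum (N + 1) x = 1 + wave 1 x * expSum N x := by
  simp only [expSum, sum_range_succ', mul_sum, ← wave_add, add_comm]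
  simp

theorem norm_expSum_le (N : ℕ) (x : ℝ) : ‖expSum N x‖ ≤ N := by
  simpa [expSum] using norm_sum_le (range N) fun l => wave l x

theorem sum_range_wave_add (n : ℤ) (N : ℕ) (x : ℝ) :
    ∑ l ∈ range N, wave (n + l) x = wave n x * expSum N x := by
  simp only [wave_add, expSum, mul_sum]

theorem two_mul_abs_le_pi_mul_norm_wave_one_sub_one {x : ℝ} (hx : |x| ≤ π) :
    2 * |x| ≤ π * ‖wave 1 x - 1‖ := by
  have hchord : ‖wave 1 x - 1‖ = 2 * |sin (x / 2)| := by
    simpa [wave] using Complex.norm_exp_I_mul_ofReal_sub_one x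
  have hjordan := mul_abs_le_abs_sin (x := x / 2) (by rw [abs_div, abs_two]; linarith)
  rw [abs_div, abs_two, div_mul_eq_mul_div, div_le_iff₀ pi_pos] at hjordan
  rw [hchord]
  linarith

theorem abs_mul_norm_expSum_le (N : ℕ) {x : ℝ} (hx : |x| ≤ π) : |x| * ‖expSum N x‖ ≤ π := by
  have hgeom : ‖expSum N x‖ * ‖wave 1 x - 1‖ ≤ 2 := by
    rw [← norm_mul, expSum, sum_congr rfl fun l _ => wave_natCast l x, geom_sum_mul,
      ← wave_natCast]
    exact (norm_sub_le_of_le (norm_wave _ _).le norm_one.le).trans_eq one_add_one_eq_two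
  have hchord := mul_le_mul_of_nonneg_left (two_mul_abs_le_pi_mul_norm_wave_one_sub_one hx)
    (norm_nonneg (expSum N x))
  nlinarith [pi_pos]

/-- An integrable majorant, of size `min (N, π / |x|)` up to a factor `2`, of all exponential sums
with at most `N` terms. -/
noncomputable def expSumMajorant (N : ℕ) (x : ℝ) : ℝ := 2 * π * N / (N * |x| + π)

@[fun_prop]
theorem continuous_expSumMajorant (N : ℕ) : Continuous (expSumMajorant N) :=
  Continuous.div (by fun_prop) (by fun_prop) fun x => by positivity

theorem norm_expSum_le_majorant {j N : ℕ} (hj : j ≤ N) {x : ℝ} (hx : |x| ≤ π) :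
    ‖expSum j x‖ ≤ expSumMajorant N x := by
  rw [expSumMajorant, le_div_iff₀ (by positivity)]
  have hlarge := mul_le_mul_of_nonneg_left (abs_mul_norm_expSum_le j hx) (Nat.cast_nonneg' N)
  have hsmall := mul_le_mul_of_nonneg_left
    ((norm_expSum_le j x).trans (Nat.cast_le.2 hj)) pi_pos.le
  linarith

theorem integral_expSumMajorant (N : ℕ) :
    ∫ x in (-π)..π, expSumMajorant N x = 4 * π * log (N + 1) := by
  have hint : ∀ a b, IntervalIntegrable (expSumMajorant N) volume a b :=
    (continuous_expSumMajorant N).intervalIntegrable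
  have hderiv : ∀ x ∈ Set.uIcc 0 π,
      HasDerivAt (fun x => 2 * π * log (N * x + π)) (expSumMajorant N x) x := by
    intro x hx
    have hx0 : 0 ≤ x := by simpa [pi_pos.le] using hx.1
    have hpos : (N : ℝ) * x + π ≠ 0 := by positivity
    refine (((((hasDerivAt_id x).const_mul (N : ℝ)).add_const π).log hpos).const_mul
      (2 * π)).congr_deriv ?_
    simp only [expSumMajorant, abs_of_nonneg hx0, id, mul_one, mul_div_assoc]
  have hright : ∫ x in 0..π, expSumMajorant N x = 2 * π * log (N + 1) := by
    rw [intervalIntegral.integral_eq_sub_of_hasDerivAt hderiv (hint _ _), ← mul_sub, mul_zero,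
      zero_add, ← log_div (by positivity) pi_ne_zero]
    congr 2
    field_simp
  have hleft : ∫ x in (-π)..0, expSumMajorant N x = ∫ x in 0..π, expSumMajorant N x := by
    simpa [expSumMajorant] using
      intervalIntegral.integral_comp_neg (a := -π) (b := 0) (expSumMajorant N)
  rw [← intervalIntegral.integral_add_adjacent_intervals (hint _ 0) (hint _ _), hleft, hright]
  ring

theorem l1Norm_sum_range_mul_wave_le (a : ℕ → ℂ) (n : ℤ) (N : ℕ) :
    l1Norm (fun x => ∑ l ∈ range (N + 1), a l * wave (n + l) x)
      ≤ (‖a N‖ + ∑ l ∈ range N, ‖a (l + 1) - a l‖) * (4 * π * log (N + 2)) := by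
  have hpointwise : ∀ x, |x| ≤ π → ‖∑ l ∈ range (N + 1), a l * wave (n + l) x‖
      ≤ (‖a N‖ + ∑ l ∈ range N, ‖a (l + 1) - a l‖) * expSumMajorant (N + 1) x := by
    refine fun x hx => norm_sum_range_smul_le a fun j hj => ?_
    rw [sum_range_wave_add, norm_mul, norm_wave, one_mul]
    exact norm_expSum_le_majorant hj hx
  have hint := l1Norm_le_integral (Continuous.intervalIntegrable (by fun_prop) _ _)
    (Continuous.intervalIntegrable (by fun_prop) _ _) hpointwise
  rwa [intervalIntegral.integral_const_mul, integral_expSumMajorant, Nat.cast_succ, add_assoc,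
    one_add_one_eq_two] at hint

end ExpSum

section Coeff

variable {f g : ℝ → ℂ}

theorem intervalIntegrable_wave_mul (hf : IntervalIntegrable f volume (-π) π) (k : ℤ) :
    IntervalIntegrable (fun x => wave k x * f x) volume (-π) π :=
  hf.continuousOn_mul (continuous_wave k).continuousOn

theorem coeff_eq_integral_wave (f : ℝ → ℂ) (n : ℤ) :
    coeff f n = (2 * π : ℂ)⁻¹ * ∫ x in (-π)..π, wave (-n) x * f x := by
  simp [coeff_eq_integral, wave]

theorem coeff_sub (hf : IntervalIntegrable f volume (-π) π)
    (hg : IntervalIntegrable g volume (-π) π) (n : ℤ) :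
    coeff (fun x => f x - g x) n = coeff f n - coeff g n := by
  simp only [coeff_eq_integral_wave, mul_sub]
  rw [intervalIntegral.integral_sub (intervalIntegrable_wave_mul hf _)
    (intervalIntegrable_wave_mul hg _), mul_sub]

theorem coeff_wave_mul (f : ℝ → ℂ) (k n : ℤ) :
    coeff (fun x => wave k x * f x) n = coeff f (n - k) := by
  simp only [coeff_eq_integral_wave, ← mul_assoc, ← wave_add, neg_sub, neg_add_eq_sub]

theorem coeff_comp_neg (f : ℝ → ℂ) (n : ℤ) : coeff (fun x => f (-x)) n = coeff f (-n) := by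
  rw [coeff_eq_integral_wave, coeff_eq_integral_wave, neg_neg]
  congr 1
  simpa [wave_apply_neg] using
    intervalIntegral.integral_comp_neg (a := -π) (b := π) fun x => wave n x * f x

/-- The trigonometric polynomial with frequencies in `s` and coefficients `a`. -/
noncomputable def trigPoly (s : Finset ℤ) (a : ℤ → ℂ) (x : ℝ) : ℂ := ∑ k ∈ s, a k * wave k x

@[fun_prop]
theorem continuous_trigPoly (s : Finset ℤ) (a : ℤ → ℂ) : Continuous (trigPoly s a) := by
  unfold trigPoly
  fun_prop

theorem partialSum_eq_trigPoly (f : ℝ → ℂ) (n : ℕ) :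
    partialSum f n = trigPoly (Icc (-(n : ℤ)) n) (coeff f) := rfl

@[fun_prop]
theorem continuous_partialSum (f : ℝ → ℂ) (n : ℕ) : Continuous (partialSum f n) :=
  continuous_trigPoly _ _

theorem partialSum_comp_neg (f : ℝ → ℂ) (n : ℕ) (x : ℝ) :
    partialSum (fun x => f (-x)) n x = partialSum f n (-x) := by
  refine sum_nbij' (-·) (-·) (by grind) (by grind) (by simp) (by simp) fun k _ => ?_
  simp [coeff_comp_neg]

theorem coeff_trigPoly (s : Finset ℤ) (a : ℤ → ℂ) (n : ℤ) :
    coeff (trigPoly s a) n = if n ∈ s then a n else 0 := by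
  have hexpand : ∀ x, wave (-n) x * trigPoly s a x = ∑ k ∈ s, a k * wave (k - n) x := fun x => by
    rw [trigPoly, mul_sum]
    exact sum_congr rfl fun k _ => by rw [sub_eq_add_neg, wave_add]; ring
  simp only [coeff_eq_integral_wave, hexpand]
  rw [intervalIntegral.integral_finsetSum fun k _ =>
    Continuous.intervalIntegrable (by fun_prop) _ _]
  have hpi : (π : ℂ) ≠ 0 := Complex.ofReal_ne_zero.2 pi_ne_zero
  simp only [intervalIntegral.integral_const_mul, integral_wave, sub_eq_zero, mul_ite, mul_zero,
    sum_ite_eq']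
  split_ifs <;> field_simp

theorem coeff_sub_partialSum (hf : IntervalIntegrable f volume (-π) π) (n : ℕ) (k : ℤ) :
    coeff (fun x => f x - partialSum f n x) k
      = if k ∈ Icc (-(n : ℤ)) n then 0 else coeff f k := by
  rw [coeff_sub hf ((continuous_partialSum f n).intervalIntegrable _ _), partialSum_eq_trigPoly,
    coeff_trigPoly]
  split_ifs <;> simp

/-- The normalized convolution `(2π)⁻¹ ∫ K(x - t) f(t) dt` over a period. -/
noncomputable def conv (K f : ℝ → ℂ) (x : ℝ) : ℂ :=
  (2 * π : ℂ)⁻¹ * ∫ t in (-π)..π, K (x - t) * f t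

theorem conv_trigPoly (s : Finset ℤ) (a : ℤ → ℂ) (hf : IntervalIntegrable f volume (-π) π)
    (x : ℝ) : conv (trigPoly s a) f x = trigPoly s (fun k => a k * coeff f k) x := by
  have hexpand : ∀ t, trigPoly s a (x - t) * f t
      = ∑ k ∈ s, a k * wave k x * (wave (-k) t * f t) := fun t => by
    simp only [trigPoly, sum_mul, wave_apply_sub, mul_assoc]
  simp only [conv, hexpand]
  rw [intervalIntegral.integral_finsetSum fun k _ =>
    (intervalIntegrable_wave_mul hf _).const_mul _, mul_sum]
  refine sum_congr rfl fun k _ => ?_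
  simp only [intervalIntegral.integral_const_mul, coeff_eq_integral_wave]
  ring

theorem norm_sum_mul_coeff_le {s : Finset ℤ} {a : ℤ → ℂ} {C : ℝ}
    (hC : ∀ x, |x| ≤ π → ‖trigPoly s a x‖ ≤ C) (hg : IntervalIntegrable g volume (-π) π) :
    ‖∑ k ∈ s, a k * coeff g k‖ ≤ (2 * π)⁻¹ * (C * l1Norm g) := by
  have hconv : ∑ k ∈ s, a k * coeff g k = conv (trigPoly s a) g 0 := by
    simp [conv_trigPoly s a hg, trigPoly, wave]
  rw [hconv, conv, norm_mul, l1Norm, ← intervalIntegral.integral_const_mul]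
  refine mul_le_mul (by simp [abs_of_pos pi_pos])
    (intervalIntegral.norm_integral_le_of_norm_le neg_pi_le_pi (.of_forall fun t ht => ?_)
      (hg.norm.const_mul C)) (norm_nonneg _) (by positivity)
  rw [norm_mul]
  refine mul_le_mul_of_nonneg_right (hC _ ?_) (norm_nonneg _)
  rw [zero_sub, abs_neg]
  exact abs_le.2 ⟨ht.1.le, ht.2⟩

end Coeff

section SineSum

/-- The partial sum `∑_{k=1}^{N} sin(kx)/k` of the sawtooth series. -/
noncomputable def sineSum (N : ℕ) (x : ℝ) : ℝ := ∑ k ∈ range N, (k + 1 : ℝ)⁻¹ * sin ((k + 1) * x)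

theorem abs_sineSum_le_mul_abs (N : ℕ) (x : ℝ) : |sineSum N x| ≤ N * |x| := by
  have hterm : ∀ k : ℕ, |(k + 1 : ℝ)⁻¹ * sin ((k + 1) * x)| ≤ |x| := fun k => by
    have hk : (0 : ℝ) < k + 1 := k.cast_add_one_pos
    rw [abs_mul, abs_of_pos (inv_pos.2 hk), inv_mul_le_iff₀ hk]
    simpa [abs_mul, abs_of_pos hk] using abs_sin_le_abs (x := (k + 1) * x)
  simpa [sineSum] using
    (abs_sum_le_sum_abs _ _).trans (sum_le_sum fun k (_ : k ∈ range N) => hterm k)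

theorem abs_mul_abs_sum_mul_sin_le {a : ℕ → ℝ} (ha : Antitone a) (ha0 : ∀ n, 0 ≤ a n) (n : ℤ)
    (N : ℕ) {x : ℝ} (hx : |x| ≤ π) :
    |x| * |∑ l ∈ range N, a l * sin ((n + l) * x)| ≤ a 0 * π := by
  have him : ∑ l ∈ range N, a l * sin ((n + l) * x)
      = (∑ l ∈ range N, a l • wave (n + l) x).im := by
    simp [Complex.im_sum, im_wave]
  have hpartial : ∀ j ≤ N, ‖∑ l ∈ range j, ((|x| : ℝ) : ℂ) * wave (n + l) x‖ ≤ π := fun j _ => by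
    simpa [← mul_sum, sum_range_wave_add] using abs_mul_norm_expSum_le j hx
  calc |x| * |∑ l ∈ range N, a l * sin ((n + l) * x)|
      ≤ |x| * ‖∑ l ∈ range N, a l • wave (n + l) x‖ := by
        rw [him]
        exact mul_le_mul_of_nonneg_left (Complex.abs_im_le_norm _) (abs_nonneg x)
    _ = ‖∑ l ∈ range N, a l • (((|x| : ℝ) : ℂ) * wave (n + l) x)‖ := by
        simp only [← mul_smul_comm, ← mul_sum, norm_mul, Complex.norm_real, norm_eq_abs, abs_abs]
    _ ≤ a 0 * π := norm_sum_range_smul_le_of_antitone ha ha0 hpartial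

/- Split at `k ≈ 1 / |x|`: below, each term is at most `|x|`; above, the sum is controlled by its
first coefficient. -/
theorem abs_sineSum_le (N : ℕ) {x : ℝ} (hx : |x| ≤ π) : |sineSum N x| ≤ π + 1 := by
  rcases (abs_nonneg x).eq_or_lt with hx0 | hx0
  · have := abs_sineSum_le_mul_abs N x
    rw [← hx0, mul_zero] at this
    linarith [pi_pos]
  let K := ⌊|x|⁻¹⌋₊
  have hK : K * |x| ≤ 1 := by
    rw [← le_div_iff₀ hx0, one_div]
    exact Nat.floor_le (by positivity)
  have hK' : 1 ≤ |x| * (K + 1) := by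
    rw [← div_le_iff₀' hx0, one_div]
    exact (Nat.lt_floor_add_one _).le
  rcases le_total N K with hNK | hKN
  · have : (N : ℝ) * |x| ≤ K * |x| := by gcongr
    linarith [abs_sineSum_le_mul_abs N x, pi_pos]
  obtain ⟨T, rfl⟩ := Nat.exists_eq_add_of_le hKN
  let tail := ∑ l ∈ range T, (K + l + 1 : ℝ)⁻¹ * sin ((K + l + 1) * x)
  have hanti : Antitone fun l : ℕ => (K + l + 1 : ℝ)⁻¹ := fun i j hij => by
    dsimp only
    gcongr
  have htail : |tail| ≤ π := by
    have habel := abs_mul_abs_sum_mul_sin_le hanti (fun l => by positivity) (K + 1) T hx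
    have : |x| * |tail| ≤ (K + 1 : ℝ)⁻¹ * π := by
      simpa [tail, add_right_comm] using habel
    rw [inv_mul_eq_div, le_div_iff₀ (by positivity)] at this
    nlinarith [abs_nonneg tail]
  have hsplit : sineSum (K + T) x = sineSum K x + tail := by
    simp [sineSum, sum_range_add, tail]
  rw [hsplit]
  linarith [abs_add_le (sineSum K x) tail, abs_sineSum_le_mul_abs K x]

/- The frequency `0` carries no mass, since `0⁻¹ = 0`. -/
theorem trigPoly_inv_eq_sineSum (N : ℕ) (x : ℝ) :
    trigPoly (Icc (-(N : ℤ)) N) (fun k => (k : ℂ)⁻¹) x = 2 * Complex.I * sineSum N x := by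
  have hsin : ∀ k : ℤ, wave k x - wave (-k) x = 2 * Complex.I * (sin (k * x) : ℝ) := fun k => by
    rw [← conj_wave, Complex.sub_conj, im_wave]
    push_cast
    ring
  rw [trigPoly, sum_Icc_neg, sineSum, Int.cast_zero, inv_zero, zero_mul, zero_add,
    Complex.ofReal_sum, mul_sum]
  refine sum_congr rfl fun k _ => ?_
  have hk := hsin (k + 1)
  push_cast at hk ⊢
  linear_combination (k + 1 : ℂ)⁻¹ * hk + wave (-(k + 1)) x * (inv_neg (a := (k + 1 : ℂ)))

/- Testing `e^{-inx} (f - S_n f)`, whose coefficients vanish on `[-2n, 0]`, against the odd kernel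
`∑_{0 < |k| ≤ 2n} e^{ikx} / k` leaves only the coefficients of `f` beyond `n`. -/
theorem norm_sum_inv_mul_coeff_le {f : ℝ → ℂ} (hf : IntervalIntegrable f volume (-π) π) (n : ℕ) :
    ‖∑ k ∈ range (2 * n), (((k + 1 : ℝ)⁻¹ : ℝ) : ℂ) * coeff f ((n + k + 1 : ℕ) : ℤ)‖
      ≤ (π + 1) / π * l1Norm (fun x => f x - partialSum f n x) := by
  let g : ℝ → ℂ := fun x => wave (-n) x * (f x - partialSum f n x)
  have hg : IntervalIntegrable g volume (-π) π :=
    intervalIntegrable_wave_mul (hf.sub ((continuous_partialSum f n).intervalIntegrable _ _)) _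
  have hcoeff : ∀ k, coeff g k = if k + n ∈ Icc (-(n : ℤ)) n then 0 else coeff f (k + n) :=
    fun k => by rw [coeff_wave_mul, sub_neg_eq_add, coeff_sub_partialSum hf]
  have hkernel : ∀ x, |x| ≤ π →
      ‖trigPoly (Icc (-((2 * n : ℕ) : ℤ)) (2 * n : ℕ)) (fun k => (k : ℂ)⁻¹) x‖
        ≤ 2 * (π + 1) := fun x hx => by
    rw [trigPoly_inv_eq_sineSum]
    simpa using abs_sineSum_le (2 * n) hx
  have hsum : ∑ k ∈ Icc (-((2 * n : ℕ) : ℤ)) (2 * n : ℕ), (k : ℂ)⁻¹ * coeff g k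
      = ∑ k ∈ range (2 * n), (((k + 1 : ℝ)⁻¹ : ℝ) : ℂ) * coeff f ((n + k + 1 : ℕ) : ℤ) := by
    rw [sum_Icc_neg, Int.cast_zero, inv_zero, zero_mul, zero_add]
    refine sum_congr rfl fun k hk => ?_
    rw [mem_range] at hk
    rw [hcoeff, hcoeff, if_neg (by grind), if_pos (by grind), mul_zero, add_zero]
    push_cast
    ring_nf
  calc _ ≤ (2 * π)⁻¹ * (2 * (π + 1) * l1Norm g) := hsum ▸ norm_sum_mul_coeff_le hkernel hg
    _ = _ := by
      rw [l1Norm_wave_mul]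
      field_simp

end SineSum

section Sector

theorem cos_mul_norm_le_re {θ : ℝ} (hθ : θ ≤ π) {z : ℂ} (hz : z ∈ sector θ) :
    cos θ * ‖z‖ ≤ z.re := by
  rw [← Complex.norm_mul_cos_arg, mul_comm, ← cos_abs z.arg]
  exact mul_le_mul_of_nonneg_left (cos_le_cos_of_nonneg_of_le_pi (abs_nonneg _) hθ hz)
    (norm_nonneg _)

theorem cos_mul_sum_mul_norm_le {ι : Type*} {θ : ℝ} (hθ : θ ≤ π) (s : Finset ι)
    {w : ι → ℝ} {c : ι → ℂ} (hw : ∀ i ∈ s, 0 ≤ w i) (hc : ∀ i ∈ s, c i ∈ sector θ) :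
    cos θ * ∑ i ∈ s, w i * ‖c i‖ ≤ ‖∑ i ∈ s, (w i : ℂ) * c i‖ := by
  refine le_trans ?_ (Complex.re_le_norm _)
  rw [Complex.re_sum, mul_sum]
  refine sum_le_sum fun i hi => ?_
  rw [Complex.re_ofReal_mul, mul_left_comm]
  exact mul_le_mul_of_nonneg_left (cos_mul_norm_le_re hθ (hc i hi)) (hw i hi)

end Sector

section GroupBV

variable {E : Type*} [SeminormedAddCommGroup E] {c : ℕ → E} {N₀ m n j : ℕ} {M B : ℝ}

/-- The variation condition of `IsGBV`, for sequences in a seminormed group and with fixed window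
length `N₀` and constant `M`. -/
def IsGroupBV (c : ℕ → E) (N₀ : ℕ) (M : ℝ) : Prop :=
  ∀ m : ℕ, 1 ≤ m → ∑ n ∈ Icc m (2 * m), ‖c n - c (n + 1)‖ ≤
    M * ((Ico m (m + N₀)).sup (fun n => ‖c n‖₊) : NNReal)

theorem IsGroupBV.sum_norm_sub_le (hc : IsGroupBV c N₀ M) (hM : 0 ≤ M) (hm : 1 ≤ m) (hB : 0 ≤ B)
    (hwindow : ∀ i < N₀, ‖c (m + i)‖ ≤ B) {s : Finset ℕ} (hs : s ⊆ Icc m (2 * m)) :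
    ∑ n ∈ s, ‖c n - c (n + 1)‖ ≤ M * B := by
  lift B to NNReal using hB
  have hsup : (Ico m (m + N₀)).sup (fun n => ‖c n‖₊) ≤ B := by
    refine Finset.sup_le fun n hn => ?_
    obtain ⟨hmn, hnN⟩ := mem_Ico.1 hn
    have := hwindow (n - m) (by omega)
    rwa [Nat.add_sub_cancel' hmn] at this
  calc ∑ n ∈ s, ‖c n - c (n + 1)‖ ≤ ∑ n ∈ Icc m (2 * m), ‖c n - c (n + 1)‖ :=
        sum_le_sum_of_subset_of_nonneg hs fun _ _ _ => norm_nonneg _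
    _ ≤ M * ((Ico m (m + N₀)).sup (fun n => ‖c n‖₊) : NNReal) := hc m hm
    _ ≤ M * B := mul_le_mul_of_nonneg_left (NNReal.coe_le_coe.2 hsup) hM

theorem IsGroupBV.norm_le_sum_window (hc : IsGroupBV c N₀ M) (hN : 1 ≤ N₀) (hM : 0 ≤ M)
    (hm : 1 ≤ m) (hmj : m ≤ j) (hj : j ≤ 2 * m + 1) :
    ‖c j‖ ≤ (M + 1) * ∑ i ∈ range N₀, ‖c (m + i)‖ := by
  have hwindow : ∀ i < N₀, ‖c (m + i)‖ ≤ ∑ i ∈ range N₀, ‖c (m + i)‖ := fun i hi =>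
    single_le_sum (f := fun i => ‖c (m + i)‖) (fun _ _ => norm_nonneg _) (mem_range.2 hi)
  have hvar := hc.sum_norm_sub_le hM hm (by positivity) hwindow (s := Ico m j) (by grind)
  have htel : ‖c m - c j‖ ≤ ∑ n ∈ Ico m j, ‖c n - c (n + 1)‖ := by
    simpa only [dist_eq_norm] using dist_le_Ico_sum_dist c hmj
  have hm : ‖c m‖ ≤ ∑ i ∈ range N₀, ‖c (m + i)‖ := hwindow 0 hN
  linarith [norm_sub_norm_le (c j) (c m), norm_sub_rev (c j) (c m)]

theorem sum_range_sum_range_add_le {b : ℕ → ℝ} (hb : ∀ k, 0 ≤ b k) (n N : ℕ) :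
    ∑ k ∈ range n, ∑ i ∈ range N, b (k + i) ≤ N * ∑ k ∈ range (n + N), b k := by
  rw [sum_comm, ← nsmul_eq_mul]
  refine (sum_le_card_nsmul _ _ _ fun i hi => ?_).trans_eq (by rw [card_range])
  rw [range_eq_Ico, sum_Ico_add' b 0 n i, range_eq_Ico]
  exact sum_le_sum_of_subset_of_nonneg (by grind) fun k _ _ => hb k

theorem log_add_one_le_sum_inv (n : ℕ) : log (n + 1) ≤ ∑ k ∈ range n, (k + 1 : ℝ)⁻¹ := by
  simpa [harmonic] using log_add_one_le_harmonic n

theorem inv_add_one_le_mul_inv {i N : ℕ} (hi : i < N) (k : ℕ) :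
    (k + 1 : ℝ)⁻¹ ≤ N * ((k + i : ℕ) + 1 : ℝ)⁻¹ := by
  have hN : (0 : ℝ) < N := by exact_mod_cast i.zero_le.trans_lt hi
  rw [← div_eq_mul_inv, inv_le_comm₀ (by positivity) (by positivity), inv_div,
    div_le_iff₀ (by positivity)]
  have hprod : k + i + 1 ≤ (k + 1) * N := by nlinarith
  exact_mod_cast hprod

theorem IsGroupBV.norm_mul_log_le (hc : IsGroupBV c N₀ M) (hN : 1 ≤ N₀) (hM : 0 ≤ M)
    (hn : N₀ ≤ n) (hj : j / 2 = n) :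
    ‖c j‖ * log (n + 1)
      ≤ (M + 1) * N₀ ^ 2 * ∑ k ∈ range (2 * n), (k + 1 : ℝ)⁻¹ * ‖c (n + k + 1)‖ := by
  let b : ℕ → ℝ := fun k => (k + 1 : ℝ)⁻¹ * ‖c (n + k + 1)‖
  have hb : ∀ k, 0 ≤ b k := fun k => by positivity
  have hterm : ∀ k ∈ range n,
      (k + 1 : ℝ)⁻¹ * ‖c j‖ ≤ (M + 1) * N₀ * ∑ i ∈ range N₀, b (k + i) := by
    intro k hk
    rw [mem_range] at hk
    have hwindow := hc.norm_le_sum_window hN hM (m := n + k + 1) (j := j) (by omega) (by omega)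
      (by omega)
    calc (k + 1 : ℝ)⁻¹ * ‖c j‖
        ≤ (k + 1 : ℝ)⁻¹ * ((M + 1) * ∑ i ∈ range N₀, ‖c (n + k + 1 + i)‖) :=
          mul_le_mul_of_nonneg_left hwindow (by positivity)
      _ = (M + 1) * ∑ i ∈ range N₀, (k + 1 : ℝ)⁻¹ * ‖c (n + k + 1 + i)‖ := by
          rw [mul_left_comm, mul_sum]
      _ ≤ (M + 1) * ∑ i ∈ range N₀, N₀ * b (k + i) := by
          refine mul_le_mul_of_nonneg_left (sum_le_sum fun i hi => ?_) (by positivity)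
          rw [← mul_assoc, ← add_assoc, add_right_comm _ 1]
          exact mul_le_mul_of_nonneg_right (inv_add_one_le_mul_inv (mem_range.1 hi) k)
            (norm_nonneg _)
      _ = (M + 1) * N₀ * ∑ i ∈ range N₀, b (k + i) := by rw [← mul_sum, mul_assoc]
  calc ‖c j‖ * log (n + 1) ≤ ∑ k ∈ range n, (k + 1 : ℝ)⁻¹ * ‖c j‖ := by
        rw [← sum_mul, mul_comm]
        exact mul_le_mul_of_nonneg_right (log_add_one_le_sum_inv n) (norm_nonneg _)
    _ ≤ (M + 1) * N₀ * ∑ k ∈ range n, ∑ i ∈ range N₀, b (k + i) := by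
        rw [mul_sum]
        exact sum_le_sum hterm
    _ ≤ (M + 1) * N₀ * (N₀ * ∑ k ∈ range (2 * n), b k) := by
        refine mul_le_mul_of_nonneg_left ((sum_range_sum_range_add_le hb n N₀).trans ?_)
          (by positivity)
        exact mul_le_mul_of_nonneg_left (sum_le_sum_of_subset_of_nonneg
          (range_subset_range.2 (by omega)) fun k _ _ => hb k) N₀.cast_nonneg
    _ = _ := by ring

end GroupBV

section Necessity

theorem log_le_two_mul_log_half_add_one (j : ℕ) : log j ≤ 2 * log ((j / 2 : ℕ) + 1) := by
  obtain rfl | hj := j.eq_zero_or_pos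
  · simp
  have hle : j ≤ (j / 2 + 1) ^ 2 := by nlinarith [Nat.lt_mul_div_succ j two_pos]
  rw [← Nat.cast_two, ← log_pow]
  exact log_le_log (by exact_mod_cast hj) (by exact_mod_cast hle)

theorem IsGBV.exists_norm_mul_log_le {c : ℕ → ℂ} (hc : IsGBV c) :
    ∃ C : ℝ, ∀ᶠ j : ℕ in atTop, ‖c j‖ * log j
      ≤ C * ‖∑ k ∈ range (2 * (j / 2)), (((k + 1 : ℝ)⁻¹ : ℝ) : ℂ) * c (j / 2 + k + 1)‖ := by
  obtain ⟨⟨θ, hθ0, hθ, hsec⟩, N₀, hN, M, hM, hvar : IsGroupBV c N₀ M⟩ := hc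
  have hcos : 0 < cos θ := cos_pos_of_mem_Ioo ⟨by linarith [pi_pos], hθ⟩
  refine ⟨2 * ((M + 1) * N₀ ^ 2 / cos θ), ?_⟩
  filter_upwards [eventually_ge_atTop (2 * N₀)] with j hj
  have hsector := cos_mul_sum_mul_norm_le (by linarith [pi_pos]) (range (2 * (j / 2)))
    (w := fun k => (k + 1 : ℝ)⁻¹) (fun k _ => by positivity)
    fun k _ => hsec (j / 2 + k + 1) (by omega)
  rw [mul_comm, ← le_div_iff₀ hcos] at hsector
  calc ‖c j‖ * log j ≤ ‖c j‖ * (2 * log ((j / 2 : ℕ) + 1)) :=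
        mul_le_mul_of_nonneg_left (log_le_two_mul_log_half_add_one j) (norm_nonneg _)
    _ = 2 * (‖c j‖ * log ((j / 2 : ℕ) + 1)) := by ring
    _ ≤ 2 * ((M + 1) * N₀ ^ 2 *
          ∑ k ∈ range (2 * (j / 2)), (k + 1 : ℝ)⁻¹ * ‖c (j / 2 + k + 1)‖) :=
        mul_le_mul_of_nonneg_left (hvar.norm_mul_log_le hN hM.le (by omega) rfl) two_pos.le
    _ ≤ 2 * ((M + 1) * N₀ ^ 2 * (_ / cos θ)) := by gcongr
    _ = _ := by ring

variable {f : ℝ → ℂ}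

theorem tendsto_norm_coeff_mul_log (hf : IntervalIntegrable f volume (-π) π)
    (hc : IsGBV (fun n : ℕ => coeff f (n : ℤ)))
    (h : Tendsto (fun n : ℕ => l1Norm (fun x => f x - partialSum f n x)) atTop (𝓝 0)) :
    Tendsto (fun n : ℕ => ‖coeff f (n : ℤ)‖ * log n) atTop (𝓝 0) := by
  obtain ⟨C, hC⟩ := hc.exists_norm_mul_log_le
  have hsum := squeeze_zero_norm (norm_sum_inv_mul_coeff_le hf)
    (by simpa using h.const_mul ((π + 1) / π))
  refine squeeze_zero' (.of_forall fun n => mul_nonneg (norm_nonneg _) (log_natCast_nonneg n)) hC ?_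
  simpa using (hsum.norm.comp (Nat.tendsto_div_const_atTop two_ne_zero)).const_mul C

theorem tendsto_norm_coeff_neg_mul_log (hf : IntervalIntegrable f volume (-π) π)
    (hc : IsGBV (fun n : ℕ => coeff f (-(n : ℤ))))
    (h : Tendsto (fun n : ℕ => l1Norm (fun x => f x - partialSum f n x)) atTop (𝓝 0)) :
    Tendsto (fun n : ℕ => ‖coeff f (-(n : ℤ))‖ * log n) atTop (𝓝 0) := by
  have hf' : IntervalIntegrable (fun x => f (-x)) volume (-π) π := by
    simpa using hf.symm.comp_sub_left 0
  have h' : Tendsto (fun n : ℕ => l1Norm (fun x => f (-x) - partialSum (fun x => f (-x)) n x))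
      atTop (𝓝 0) := by
    simp only [partialSum_comp_neg]
    exact h.congr fun n => (l1Norm_comp_neg fun x => f x - partialSum f n x).symm
  simpa only [coeff_comp_neg] using
    tendsto_norm_coeff_mul_log hf' (by simpa only [coeff_comp_neg] using hc) h'

end Necessity

section DeLaValleePoussin

/-- The Dirichlet kernel `∑_{|k| ≤ N} e^{ikx}`. -/
noncomputable def dirichletKernel (N : ℕ) : ℝ → ℂ := trigPoly (Icc (-(N : ℤ)) N) fun _ => 1

@[fun_prop]
theorem continuous_dirichletKernel (N : ℕ) : Continuous (dirichletKernel N) :=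
  continuous_trigPoly _ _

theorem integral_dirichletKernel (N : ℕ) : ∫ x in (-π)..π, dirichletKernel N x = 2 * π := by
  have h := coeff_trigPoly (Icc (-(N : ℤ)) N) (fun _ => 1) 0
  simp only [coeff_eq_integral_wave, neg_zero, wave_zero, one_mul] at h
  rw [if_pos (by simp), inv_mul_eq_iff_eq_mul₀ (by simp [pi_ne_zero]), mul_one] at h
  exact h

theorem dirichletKernel_eq_expSum (N : ℕ) (x : ℝ) :
    dirichletKernel N x
      = 1 + wave (-N) x * expSum N x + wave N x * starRingEnd ℂ (expSum N x) := by
  induction N with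
  | zero => simp [dirichletKernel, trigPoly, expSum]
  | succ N ih =>
    have hsucc : dirichletKernel (N + 1) x
        = wave (N + 1) x + wave (-(N + 1)) x + dirichletKernel N x := by
      simp only [dirichletKernel, trigPoly, Nat.cast_succ, sum_Icc_succ_eq_add_endpoints, one_mul]
    rw [hsucc, ih, expSum_succ', map_add, map_mul, map_one, conj_wave]
    push_cast
    rw [neg_add, wave_add, wave_add]
    linear_combination -(wave (-N) x * expSum N x + wave N x * starRingEnd ℂ (expSum N x)) *
      wave_mul_wave_neg 1 x

theorem sum_dirichletKernel (N : ℕ) (x : ℝ) :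
    ∑ m ∈ range N, dirichletKernel m x = ((‖expSum N x‖ ^ 2 : ℝ) : ℂ) := by
  push_cast
  rw [← Complex.mul_conj']
  induction N with
  | zero => simp [expSum]
  | succ N ih =>
    rw [sum_range_succ, ih, dirichletKernel_eq_expSum, expSum_succ, map_add, conj_wave]
    linear_combination -wave_mul_wave_neg N x

theorem integral_norm_expSum_sq (N : ℕ) : ∫ x in (-π)..π, ‖expSum N x‖ ^ 2 = 2 * π * N := by
  have h : ∫ x in (-π)..π, ((‖expSum N x‖ ^ 2 : ℝ) : ℂ) = 2 * π * N := by
    simp only [← sum_dirichletKernel]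
    rw [intervalIntegral.integral_finsetSum fun m _ =>
      Continuous.intervalIntegrable (by fun_prop) _ _]
    simp [integral_dirichletKernel, mul_comm]
  rw [intervalIntegral.integral_ofReal] at h
  exact_mod_cast h

/-- The de la Vallée Poussin kernel, the average of the Dirichlet kernels of orders
`n, …, 2n - 1`. -/
noncomputable def vpKernel (n : ℕ) (x : ℝ) : ℂ :=
  (n : ℂ)⁻¹ * ∑ m ∈ range n, dirichletKernel (n + m) x

@[fun_prop]
theorem continuous_vpKernel (n : ℕ) : Continuous (vpKernel n) := by
  unfold vpKernel
  fun_prop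

theorem vpKernel_periodic (n : ℕ) : Function.Periodic (vpKernel n) (2 * π) := fun x => by
  simp only [vpKernel, dirichletKernel, trigPoly, (wave_periodic _) x]

theorem norm_vpKernel_le (n : ℕ) (x : ℝ) :
    ‖vpKernel n x‖ ≤ (n : ℝ)⁻¹ * (‖expSum (n + n) x‖ ^ 2 + ‖expSum n x‖ ^ 2) := by
  have hfejer : ∑ m ∈ range n, dirichletKernel (n + m) x
      = ((‖expSum (n + n) x‖ ^ 2 : ℝ) : ℂ) - ((‖expSum n x‖ ^ 2 : ℝ) : ℂ) := by
    rw [← sum_dirichletKernel, ← sum_dirichletKernel, sum_range_add, add_sub_cancel_left]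
  rw [vpKernel, hfejer, norm_mul, norm_inv, Complex.norm_natCast]
  refine mul_le_mul_of_nonneg_left ((norm_sub_le _ _).trans_eq ?_) (by positivity)
  simp only [Complex.norm_real, norm_pow, norm_norm]

theorem l1Norm_vpKernel_le (n : ℕ) : l1Norm (vpKernel n) ≤ 6 * π := by
  have hint : ∀ N, IntervalIntegrable (fun x => ‖expSum N x‖ ^ 2) volume (-π) π :=
    fun N => Continuous.intervalIntegrable (by fun_prop) _ _
  refine (l1Norm_le_integral (Continuous.intervalIntegrable (by fun_prop) _ _)
    (((hint _).add (hint _)).const_mul _) fun x _ => norm_vpKernel_le n x).trans ?_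
  rw [intervalIntegral.integral_const_mul, intervalIntegral.integral_add (hint _) (hint _),
    integral_norm_expSum_sq, integral_norm_expSum_sq, Nat.cast_add]
  calc (n : ℝ)⁻¹ * (2 * π * (n + n) + 2 * π * n) = (n : ℝ)⁻¹ * n * (6 * π) := by ring
    _ ≤ 6 * π := mul_le_of_le_one_left (by positivity) inv_mul_le_one

variable {K f g : ℝ → ℂ}

theorem l1Norm_comp_sub_right (hK : Function.Periodic K (2 * π)) (t : ℝ) :
    l1Norm (fun x => K (x - t)) = l1Norm K := by
  have hnorm : Function.Periodic (fun x => ‖K x‖) (2 * π) := hK.comp norm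
  have hshift := hnorm.intervalIntegral_add_eq (-π - t) (-π)
  rw [show -π - t + 2 * π = π - t by ring, show -π + 2 * π = π by ring] at hshift
  rw [l1Norm, intervalIntegral.integral_comp_sub_right fun x => ‖K x‖, hshift, l1Norm]

theorem l1Norm_conv_le (hK : Continuous K) (hper : Function.Periodic K (2 * π))
    (hf : IntervalIntegrable f volume (-π) π) :
    l1Norm (conv K f) ≤ (2 * π)⁻¹ * (l1Norm K * l1Norm f) := by
  obtain ⟨C, hC⟩ := (hper.isBounded_of_continuous two_pi_pos.ne' hK).exists_norm_le
  let μ : Measure ℝ := volume.restrict (Set.Ioc (-π) π)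
  have hμ : ∀ b : ℝ → ℝ, ∫ x in (-π)..π, b x = ∫ x, b x ∂μ := fun b =>
    intervalIntegral.integral_of_le neg_pi_le_pi
  have hfμ : Integrable f μ := (intervalIntegrable_iff_integrableOn_Ioc_of_le neg_pi_le_pi).1 hf
  have hprod : Integrable (fun p : ℝ × ℝ => K (p.1 - p.2) * f p.2) (μ.prod μ) :=
    (hfμ.comp_snd μ).bdd_mul (Continuous.aestronglyMeasurable (by fun_prop))
      (.of_forall fun p => hC _ ⟨_, rfl⟩)
  have hconv : ∀ x, ‖conv K f x‖ ≤ (2 * π)⁻¹ * ∫ t, ‖K (x - t) * f t‖ ∂μ := fun x => by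
    rw [conv, norm_mul, intervalIntegral.integral_of_le neg_pi_le_pi]
    exact mul_le_mul (by simp [abs_of_pos pi_pos]) (norm_integral_le_integral_norm _)
      (norm_nonneg _) (by positivity)
  have hinner : ∀ t, ∫ x, ‖K (x - t)‖ ∂μ = l1Norm K := fun t =>
    (hμ _).symm.trans (l1Norm_comp_sub_right hper t)
  calc l1Norm (conv K f) = ∫ x, ‖conv K f x‖ ∂μ := hμ _
    _ ≤ ∫ x, (2 * π)⁻¹ * ∫ t, ‖K (x - t) * f t‖ ∂μ ∂μ :=
        integral_mono_of_nonneg (.of_forall fun _ => norm_nonneg _)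
          (hprod.norm.integral_prod_left.const_mul _) (.of_forall hconv)
    _ = (2 * π)⁻¹ * ∫ t, ∫ x, ‖K (x - t) * f t‖ ∂μ ∂μ := by
        rw [integral_const_mul, integral_integral_swap hprod.norm]
    _ = (2 * π)⁻¹ * ∫ t, l1Norm K * ‖f t‖ ∂μ := by
        simp only [norm_mul, integral_mul_const, hinner]
    _ = (2 * π)⁻¹ * (l1Norm K * l1Norm f) := by rw [integral_const_mul, ← hμ]; rfl

/-- The de la Vallée Poussin mean, the average of the partial sums of orders `n, …, 2n - 1`. -/
noncomputable def vpMean (f : ℝ → ℂ) (n : ℕ) (x : ℝ) : ℂ :=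
  (n : ℂ)⁻¹ * ∑ m ∈ range n, partialSum f (n + m) x

@[fun_prop]
theorem continuous_vpMean (f : ℝ → ℂ) (n : ℕ) : Continuous (vpMean f n) := by
  unfold vpMean
  fun_prop

theorem partialSum_eq_conv (hf : IntervalIntegrable f volume (-π) π) (n : ℕ) (x : ℝ) :
    partialSum f n x = conv (dirichletKernel n) f x := by
  simp only [dirichletKernel, conv_trigPoly _ _ hf, one_mul, partialSum_eq_trigPoly]

theorem vpMean_eq_conv (hf : IntervalIntegrable f volume (-π) π) (n : ℕ) :
    vpMean f n = conv (vpKernel n) f := by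
  ext x
  have hint : ∀ m ∈ range n,
      IntervalIntegrable (fun t => dirichletKernel (n + m) (x - t) * f t) volume (-π) π :=
    fun m _ => hf.continuousOn_mul (Continuous.continuousOn (by fun_prop))
  simp only [conv, vpKernel, mul_assoc, sum_mul]
  rw [intervalIntegral.integral_const_mul, intervalIntegral.integral_finsetSum hint, vpMean]
  simp only [partialSum_eq_conv hf, conv, ← mul_sum]
  ring

theorem l1Norm_vpMean_le (hf : IntervalIntegrable f volume (-π) π) (n : ℕ) :
    l1Norm (vpMean f n) ≤ 3 * l1Norm f := by
  rw [vpMean_eq_conv hf]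
  calc l1Norm (conv (vpKernel n) f) ≤ (2 * π)⁻¹ * (l1Norm (vpKernel n) * l1Norm f) :=
        l1Norm_conv_le (continuous_vpKernel n) (vpKernel_periodic n) hf
    _ ≤ (2 * π)⁻¹ * (6 * π * l1Norm f) := by
        gcongr
        exacts [l1Norm_nonneg f, l1Norm_vpKernel_le n]
    _ = 3 * l1Norm f := by
        field_simp
        ring

theorem vpMean_sub (hf : IntervalIntegrable f volume (-π) π)
    (hg : IntervalIntegrable g volume (-π) π) (n : ℕ) (x : ℝ) :
    vpMean (fun x => f x - g x) n x = vpMean f n x - vpMean g n x := by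
  simp only [vpMean, partialSum, coeff_sub hf hg, sub_mul, sum_sub_distrib, mul_sub]

theorem partialSum_trigPoly {s : Finset ℤ} {n : ℕ} (hs : s ⊆ Icc (-(n : ℤ)) n) (a : ℤ → ℂ) :
    partialSum (trigPoly s a) n = trigPoly s a := by
  ext x
  simp only [partialSum_eq_trigPoly, trigPoly, coeff_trigPoly, ite_mul, zero_mul, sum_ite_mem,
    inter_eq_right.2 hs]

theorem vpMean_trigPoly {s : Finset ℤ} {n : ℕ} (hn : n ≠ 0) (hs : s ⊆ Icc (-(n : ℤ)) n)
    (a : ℤ → ℂ) : vpMean (trigPoly s a) n = trigPoly s a := by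
  ext x
  have hpartial : ∀ m, partialSum (trigPoly s a) (n + m) = trigPoly s a := fun m =>
    partialSum_trigPoly (hs.trans (Icc_subset_Icc (by grind) (by grind))) a
  simp only [vpMean, hpartial, sum_const, card_range, nsmul_eq_mul]
  exact inv_mul_cancel_left₀ (Nat.cast_ne_zero.2 hn) _

end DeLaValleePoussin

section Density

theorem exists_integral_norm_sub_sum_fourier_lt {T : ℝ} [Fact (0 < T)] {F : AddCircle T → ℂ}
    (hF : Integrable F AddCircle.haarAddCircle) {ε : ℝ} (hε : 0 < ε) :
    ∃ (s : Finset ℤ) (a : ℤ → ℂ),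
      ∫ y, ‖F y - ∑ k ∈ s, a k * fourier k y‖ ∂AddCircle.haarAddCircle < ε := by
  obtain ⟨φ, -, hFφ, hφ, hφi⟩ := hF.exists_hasCompactSupport_integral_sub_le (half_pos hε)
  lift φ to C(AddCircle T, ℂ) using hφ
  have hdense : φ ∈
      (Submodule.span ℂ (Set.range (fourier (T := T)))).topologicalClosure := by
    rw [span_fourier_closure_eq_top]
    trivial
  obtain ⟨P, hP, hφP⟩ := Metric.mem_closure_iff.1 hdense (ε / 2) (half_pos hε)
  obtain ⟨a, rfl⟩ := Finsupp.mem_span_range_iff_exists_finsupp.1 hP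
  refine ⟨a.support, a, ?_⟩
  set P : C(AddCircle T, ℂ) := a.sum fun k z => z • fourier k
  have hP_apply : ∀ y, P y = ∑ k ∈ a.support, a k * fourier k y := fun y => by
    simp only [P, Finsupp.sum, ContinuousMap.sum_apply, ContinuousMap.smul_apply, smul_eq_mul]
  have hpointwise : ∀ y, ‖F y - P y‖ ≤ ‖F y - φ y‖ + dist φ P := fun y =>
    (norm_sub_le_norm_sub_add_norm_sub _ (φ y) _).trans
      (add_le_add_right ((dist_eq_norm _ _).symm.trans_le
        (ContinuousMap.dist_apply_le_dist y)) _)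
  have hFφi : Integrable (fun y => ‖F y - φ y‖) AddCircle.haarAddCircle := (hF.sub hφi).norm
  calc ∫ y, ‖F y - ∑ k ∈ a.support, a k * fourier k y‖ ∂AddCircle.haarAddCircle
      = ∫ y, ‖F y - P y‖ ∂AddCircle.haarAddCircle := by simp only [hP_apply]
    _ ≤ ∫ y, (‖F y - φ y‖ + dist φ P) ∂AddCircle.haarAddCircle :=
        integral_mono_of_nonneg (.of_forall fun _ => norm_nonneg _)
          (hFφi.add (integrable_const _)) (.of_forall hpointwise)
    _ = (∫ y, ‖F y - φ y‖ ∂AddCircle.haarAddCircle) + dist φ P := by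
        rw [integral_add hFφi (integrable_const _), integral_const, probReal_univ, one_smul]
    _ < ε := by linarith

theorem fourier_coe_eq_wave (k : ℤ) (x : ℝ) :
    fourier k (x : AddCircle (2 * π)) = wave k x := by
  rw [fourier_coe_apply, wave]
  congr 1
  push_cast
  field_simp

theorem exists_l1Norm_sub_trigPoly_lt {f : ℝ → ℂ} (hf : IntervalIntegrable f volume (-π) π)
    {ε : ℝ} (hε : 0 < ε) :
    ∃ (s : Finset ℤ) (a : ℤ → ℂ), l1Norm (fun x => f x - trigPoly s a x) < ε := by
  have : Fact (0 < 2 * π) := ⟨two_pi_pos⟩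
  have hend : -π + 2 * π = π := by ring
  have hF : MemLp (AddCircle.liftIoc (2 * π) (-π) f) 1 AddCircle.haarAddCircle := by
    refine MemLp.haarAddCircle (MemLp.memLp_liftIoc ?_)
    rw [hend, memLp_one_iff_integrable]
    exact (intervalIntegrable_iff_integrableOn_Ioc_of_le neg_pi_le_pi).1 hf
  obtain ⟨s, a, hsa⟩ := exists_integral_norm_sub_sum_fourier_lt (memLp_one_iff_integrable.1 hF)
    (div_pos hε two_pi_pos)
  refine ⟨s, a, ?_⟩
  rw [AddCircle.integral_haarAddCircle, ← AddCircle.intervalIntegral_preimage (2 * π) (-π), hend,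
    smul_eq_mul, inv_mul_eq_div, div_lt_div_iff_of_pos_right two_pi_pos] at hsa
  refine lt_of_eq_of_lt (intervalIntegral.integral_congr_ae (.of_forall fun x hx => ?_)) hsa
  rw [Set.uIoc_of_le neg_pi_le_pi] at hx
  simp only [AddCircle.liftIoc_coe_apply (by rwa [hend] : x ∈ Set.Ioc (-π) (-π + 2 * π)),
    fourier_coe_eq_wave, trigPoly]

theorem tendsto_l1Norm_sub_vpMean {f : ℝ → ℂ} (hf : IntervalIntegrable f volume (-π) π) :
    Tendsto (fun n : ℕ => l1Norm (fun x => f x - vpMean f n x)) atTop (𝓝 0) := by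
  rw [Metric.tendsto_nhds]
  intro ε hε
  obtain ⟨s, a, hsa⟩ := exists_l1Norm_sub_trigPoly_lt hf (by positivity : 0 < ε / 4)
  filter_upwards [eventually_ge_atTop (max 1 (s.sup Int.natAbs))] with n hn
  have hs : s ⊆ Icc (-(n : ℤ)) n := fun k hk => by
    have := (le_sup (f := Int.natAbs) hk).trans ((le_max_right _ _).trans hn)
    grind
  set P := trigPoly s a
  have hfP : IntervalIntegrable (fun x => f x - P x) volume (-π) π :=
    hf.sub (Continuous.intervalIntegrable (by fun_prop) _ _)
  have hsplit : (fun x => f x - vpMean f n x)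
      = fun x => (f x - P x) + (-1) * vpMean (fun x => f x - P x) n x := by
    ext x
    rw [vpMean_sub hf (Continuous.intervalIntegrable (by fun_prop) _ _),
      vpMean_trigPoly (by grind) hs]
    ring
  rw [Real.dist_eq, sub_zero, abs_of_nonneg (l1Norm_nonneg _), hsplit]
  refine (l1Norm_add_le hfP (Continuous.intervalIntegrable (by fun_prop) _ _)).trans_lt ?_
  rw [l1Norm_const_mul, norm_neg, norm_one, one_mul]
  linarith [l1Norm_vpMean_le hfP n]

end Density

section Sufficiency

variable {c : ℕ → ℂ} {f : ℝ → ℂ} {n N : ℕ}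

theorem log_add_one_le_two_mul_log (hn : 2 ≤ n) : log (n + 1) ≤ 2 * log n := by
  have hle : n + 1 ≤ n ^ 2 := by nlinarith
  rw [← Nat.cast_two, ← log_pow]
  exact log_le_log (by positivity) (by exact_mod_cast hle)

theorem IsGroupBV.l1Norm_block_le {N₀ : ℕ} {M B : ℝ} (hc : IsGroupBV c N₀ M) (hM : 0 ≤ M)
    (hB : ∀ k, n ≤ k → ‖c k‖ ≤ B) (hn : 2 ≤ n) (hN : N ≤ n) :
    l1Norm (fun x => ∑ l ∈ range N, c (n + 1 + l) * wave (n + 1 + l) x)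
      ≤ 8 * π * (1 + M) * (B * log n) := by
  have hB0 : 0 ≤ B := (norm_nonneg _).trans (hB n le_rfl)
  obtain _ | T := N
  · simpa [l1Norm] using by positivity
  have hvar : ∑ l ∈ range T, ‖c (n + 1 + (l + 1)) - c (n + 1 + l)‖ ≤ M * B := by
    have hsum := hc.sum_norm_sub_le hM (s := Ico (n + 1) (n + 1 + T)) (by omega : 1 ≤ n) hB0
      (fun i _ => hB _ (by omega)) (fun k hk => by grind)
    simpa only [sum_Ico_eq_sum_range, Nat.add_sub_cancel_left, norm_sub_rev, ← add_assoc]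
      using hsum
  have hlog : log (T + 2) ≤ 2 * log n := by
    refine (log_le_log (by positivity) ?_).trans (log_add_one_le_two_mul_log hn)
    have : (T : ℝ) + 1 ≤ n := by exact_mod_cast hN
    linarith
  have hlog0 : 0 ≤ log ((T : ℝ) + 2) := log_nonneg (by linarith [T.cast_nonneg (α := ℝ)])
  calc _ ≤ (‖c (n + 1 + T)‖ + ∑ l ∈ range T, ‖c (n + 1 + (l + 1)) - c (n + 1 + l)‖)
          * (4 * π * log (T + 2)) :=
        l1Norm_sum_range_mul_wave_le (fun l => c (n + 1 + l)) (n + 1) T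
    _ ≤ (B + M * B) * (4 * π * (2 * log n)) := by
        have := hB (n + 1 + T) (by omega)
        gcongr
    _ = 8 * π * (1 + M) * (B * log n) := by ring

theorem IsGBV.eventually_l1Norm_block_le (hc : IsGBV c)
    (h : Tendsto (fun n : ℕ => ‖c n‖ * log n) atTop (𝓝 0)) {ε : ℝ} (hε : 0 < ε) :
    ∀ᶠ n : ℕ in atTop, ∀ N ≤ n,
      l1Norm (fun x => ∑ l ∈ range N, c (n + 1 + l) * wave (n + 1 + l) x) ≤ ε := by
  obtain ⟨-, N₀, -, M, hM, hvar : IsGroupBV c N₀ M⟩ := hc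
  have hδ : 0 < ε / (8 * π * (1 + M)) := by positivity
  filter_upwards [eventually_forall_ge_atTop.2 (h.eventually (gt_mem_nhds hδ)),
    eventually_ge_atTop 2] with n hn hn2 N hN
  have hlog : 0 < log n := log_pos (by exact_mod_cast hn2)
  have hbound : ∀ k, n ≤ k → ‖c k‖ ≤ ε / (8 * π * (1 + M)) / log n := fun k hk => by
    rw [le_div_iff₀ hlog]
    exact (mul_le_mul_of_nonneg_left (log_le_log (by positivity) (Nat.cast_le.2 hk))
      (norm_nonneg _)).trans (hn k hk).le
  refine (hvar.l1Norm_block_le hM.le hbound hn2 hN).trans_eq ?_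
  field_simp

theorem partialSum_add_sub (f : ℝ → ℂ) (n N : ℕ) (x : ℝ) :
    partialSum f (n + N) x - partialSum f n x
      = ∑ l ∈ range N, coeff f ((n + 1 + l : ℕ) : ℤ) * wave (n + 1 + l) x
        + ∑ l ∈ range N, coeff f (-((n + 1 + l : ℕ) : ℤ)) * wave (n + 1 + l) (-x) := by
  rw [partialSum_eq_trigPoly, partialSum_eq_trigPoly, trigPoly, trigPoly, sum_Icc_neg_add,
    add_sub_cancel_left, sum_add_distrib]
  simp only [wave_apply_neg]
  push_cast
  rfl

theorem eventually_l1Norm_partialSum_add_sub_le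
    (hpos : IsGBV fun n : ℕ => coeff f n) (hneg : IsGBV fun n : ℕ => coeff f (-(n : ℤ)))
    (hpos0 : Tendsto (fun n : ℕ => ‖coeff f n‖ * log n) atTop (𝓝 0))
    (hneg0 : Tendsto (fun n : ℕ => ‖coeff f (-(n : ℤ))‖ * log n) atTop (𝓝 0))
    {ε : ℝ} (hε : 0 < ε) :
    ∀ᶠ n : ℕ in atTop, ∀ N ≤ n,
      l1Norm (fun x => partialSum f (n + N) x - partialSum f n x) ≤ ε := by
  filter_upwards [hpos.eventually_l1Norm_block_le hpos0 (half_pos hε),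
    hneg.eventually_l1Norm_block_le hneg0 (half_pos hε)] with n hn hn' N hN
  simp only [partialSum_add_sub]
  refine (l1Norm_add_le (Continuous.intervalIntegrable (by fun_prop) _ _)
    (Continuous.intervalIntegrable (by fun_prop) _ _)).trans ?_
  rw [l1Norm_comp_neg fun x => ∑ l ∈ range N,
    coeff f (-((n + 1 + l : ℕ) : ℤ)) * wave (n + 1 + l) x]
  linarith [hn N hN, hn' N hN]

theorem l1Norm_vpMean_sub_partialSum_le {δ : ℝ} (hn : n ≠ 0)
    (h : ∀ m < n, l1Norm (fun x => partialSum f (n + m) x - partialSum f n x) ≤ δ) :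
    l1Norm (fun x => vpMean f n x - partialSum f n x) ≤ δ := by
  have hn0 : (n : ℝ) ≠ 0 := Nat.cast_ne_zero.2 hn
  have hmean : (fun x => vpMean f n x - partialSum f n x) = fun x =>
      (n : ℂ)⁻¹ * ∑ m ∈ range n, (partialSum f (n + m) x - partialSum f n x) := by
    ext x
    rw [sum_sub_distrib, sum_const, card_range, nsmul_eq_mul, mul_sub,
      inv_mul_cancel_left₀ (Nat.cast_ne_zero.2 hn), vpMean]
  rw [hmean, l1Norm_const_mul, norm_inv, Complex.norm_natCast]
  calc (n : ℝ)⁻¹ * l1Norm (fun x => ∑ m ∈ range n, (partialSum f (n + m) x - partialSum f n x))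
      ≤ (n : ℝ)⁻¹ * ∑ m ∈ range n,
          l1Norm (fun x => partialSum f (n + m) x - partialSum f n x) := by
        gcongr
        exact l1Norm_sum_le _ fun m _ => Continuous.intervalIntegrable (by fun_prop) _ _
    _ ≤ (n : ℝ)⁻¹ * ∑ _ ∈ range n, δ := by
        gcongr with _ hm
        exact h _ (mem_range.1 hm)
    _ = δ := by rw [sum_const, card_range, nsmul_eq_mul, inv_mul_cancel_left₀ hn0]

theorem tendsto_l1Norm_sub_partialSum (hf : IntervalIntegrable f volume (-π) π)
    (hpos : IsGBV fun n : ℕ => coeff f n) (hneg : IsGBV fun n : ℕ => coeff f (-(n : ℤ)))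
    (hpos0 : Tendsto (fun n : ℕ => ‖coeff f n‖ * log n) atTop (𝓝 0))
    (hneg0 : Tendsto (fun n : ℕ => ‖coeff f (-(n : ℤ))‖ * log n) atTop (𝓝 0)) :
    Tendsto (fun n : ℕ => l1Norm (fun x => f x - partialSum f n x)) atTop (𝓝 0) := by
  rw [Metric.tendsto_nhds]
  intro ε hε
  filter_upwards [(tendsto_l1Norm_sub_vpMean hf).eventually (gt_mem_nhds (half_pos hε)),
    eventually_l1Norm_partialSum_add_sub_le hpos hneg hpos0 hneg0 (half_pos hε),
    eventually_ne_atTop 0] with n hmean hblock hn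
  have hdiff := l1Norm_vpMean_sub_partialSum_le hn fun m hm => hblock m hm.le
  have htri := l1Norm_add_le (g := fun x => f x - vpMean f n x)
    (h := fun x => vpMean f n x - partialSum f n x)
    (hf.sub (Continuous.intervalIntegrable (by fun_prop) _ _))
    (Continuous.intervalIntegrable (by fun_prop) _ _)
  simp only [sub_add_sub_cancel] at htri
  rw [Real.dist_eq, sub_zero, abs_of_nonneg (l1Norm_nonneg _)]
  linarith

end Sufficiency

theorem tendsto_int_iff_tendsto_nat {α : Type*} {g : ℤ → α} {l : Filter α} :
    Tendsto g (atBot ⊔ atTop) l ↔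
      Tendsto (fun n : ℕ => g n) atTop l ∧ Tendsto (fun n : ℕ => g (-(n : ℤ))) atTop l := by
  rw [tendsto_sup, and_comm, ← map_neg_atTop, ← Nat.map_cast_int_atTop, tendsto_map'_iff,
    tendsto_map'_iff, tendsto_map'_iff]
  rfl

end GBVFourier

theorem corollary1 (f : ℝ → ℂ) (hper : Function.Periodic f (2 * Real.pi))
    (hint : IntervalIntegrable f volume (-Real.pi) Real.pi)
    (hpos : GBVFourier.IsGBV (fun n : ℕ => GBVFourier.coeff f (n : ℤ)))
    (hneg : GBVFourier.IsGBV (fun n : ℕ => GBVFourier.coeff f (-(n : ℤ)))) :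
    Tendsto (fun n : ℕ => GBVFourier.l1Norm (fun x => f x - GBVFourier.partialSum f n x))
        atTop (𝓝 0) ↔
      Tendsto (fun n : ℤ => GBVFourier.coeff f n * (Real.log |(n : ℝ)| : ℂ))
        (atBot ⊔ atTop) (𝓝 0) := by
  have hnorm : ∀ (z : ℂ) (n : ℕ), ‖z * (Real.log n : ℂ)‖ = ‖z‖ * Real.log n := fun z n => by
    rw [norm_mul, Complex.norm_real, Real.norm_of_nonneg (Real.log_natCast_nonneg n)]
  rw [GBVFourier.tendsto_int_iff_tendsto_nat,
    tendsto_zero_iff_norm_tendsto_zero (f := fun n : ℕ => GBVFourier.coeff f (n : ℤ) * _),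
    tendsto_zero_iff_norm_tendsto_zero (f := fun n : ℕ => GBVFourier.coeff f (-(n : ℤ)) * _)]
  simp only [Int.cast_neg, Int.cast_natCast, abs_neg, Nat.abs_cast, hnorm]
  exact ⟨fun h => ⟨GBVFourier.tendsto_norm_coeff_mul_log hint hpos h,
      GBVFourier.tendsto_norm_coeff_neg_mul_log hint hneg h⟩,
    fun h => GBVFourier.tendsto_l1Norm_sub_partialSum hint hpos hneg h.1 h.2⟩
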